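/- **Conventions.** Work over a field $K$. Graded vector spaces are $\mathbb Z$-graded, differentials have degree $-1$, and the Koszul sign rule is used for tensor products of maps: $(f\otimes g)(a\otimes b)=(-1)^{|g||a|}f(a)\otimes g(b)$. A *DG hom-associative algebra* is a chain complex $(A=\bigoplus_n A_n,d_A)$ with a bilinear map $\mu:A\otimes A\to A$ and a linear map $\alpha:A\to A$, both of degree $0$, such that for all $b,c\in A$ and homogeneous $a\in A$: $\alpha\mu(a,b)=\mu(\alpha a,\alpha b)$, $\mu(\alpha a,\mu(b,c))=\mu(\mu(a,b),\alpha c)$, $\alpha d_A=d_A\alpha$ and $d_A\mu(a,b)=\mu(d_Aa,b)+(-1)^{|a|}\mu(a,d_Ab)$. An *$HA_\infty$-algebra* is a graded vector space $V$ with linear maps $\mu_k:V^{\otimes k}\to V$ of degree $k-2$ ($k\ge 1$) and a linear map $\alpha:V\to V$ of degree $0$ with $\alpha\circ\mu_k=\mu_k\circ\alpha^{\otimes k}$ for all $k\ge1$, such that for all $n\ge1$ and homogeneous $v_1,\dots,v_n\in V$ $$\sum_{i+j=n+1}\ \sum_{\lambda=1}^{j}(-1)^{\lambda(i+1)+i(|v_1|+\cdots+|v_{\lambda-1}|)}\,\mu_j\big(\alpha^{i-1}v_1,\dots,\alpha^{i-1}v_{\lambda-1},\mu_i(v_\lambda,\dots,v_{\lambda+i-1}),\alpha^{i-1}v_{\lambda+i},\dots,\alpha^{i-1}v_n\big)=0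 .$$ A *contraction* from a chain complex $(A,d_A)$ to a chain complex $(H,d_H)$ consists of chain maps $p:A\to H$, $i:H\to A$ and a linear map $h:A\to A$ of degree $+1$ with $1_A-i\circ p=d_Ah+hd_A$ and $p\circ i=1_H$. **Theorem.** Let $(A,\mu,\alpha,d_A)$ be a DG hom-associative algebra and let $(p,i,h)$ be a contraction from $(A,d_A)$ to a chain complex $(H,d_H)$ with $\alpha\circ h=h\circ\alpha$. For a planar binary tree $T$ with $k\ge2$ leaves, write $T=T_1\vee T_2$ as the grafting of a tree $T_1$ with $r$ leaves and a tree $T_2$ with $s$ leaves ($r+s=k$), and define recursively $$\mu_T=(-1)^{r(s+1)}\,\mu\circ\big((\alpha^{s-1}\circ h\circ\mu_{T_1})\otimes(\alpha^{r-1}\circ h\circ\mu_{T_2})\big):A^{\otimes k}\to A,$$ where $h\circ\mu_{T'}$ is read as $\mathrm{id}_A$ if $T'$ is the tree with one leaf. Put $\mu_k^A=\sum_T\mu_T$, the sum over all planar binary trees $T$ with $k$ leaves (so $\mu_2^A=\mu$). Then the maps $$\mu_1^H=d_H,\qquad \mu_k^H=(-1)^k\,p\circ\mu_k^A\circ i^{\otimes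 k}\ \ (k\ge2),\qquad \alpha_H=p\circ\alpha\circ i$$ make $H$ into an $HA_\infty$-algebra. -/

import Mathlib

/-- A chain complex structure on the graded vector space `A = ⨁ₙ 𝒜 n` (internally `ℤ`-graded):
a differential of degree `-1`. -/
structure ChainCx {K A : Type*} [Field K] [AddCommGroup A] [Module K A]
    (𝒜 : ℤ → Submodule K A) where
  d : A →ₗ[K] A
  d_mem : ∀ (n : ℤ) (a : A), a ∈ 𝒜 n → d a ∈ 𝒜 (n - 1)
  d_d : ∀ a : A, d (d a) = 0

/-- A differential graded hom-associative algebra (multiplicative, i.e. `α` preserves `μ`). -/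
structure DGHomAssoc {K A : Type*} [Field K] [AddCommGroup A] [Module K A]
    (𝒜 : ℤ → Submodule K A) extends ChainCx 𝒜 where
  μ : A →ₗ[K] A →ₗ[K] A
  α : Module.End K A
  μ_mem : ∀ (m n : ℤ) (a b : A), a ∈ 𝒜 m → b ∈ 𝒜 n → μ a b ∈ 𝒜 (m + n)
  α_mem : ∀ (n : ℤ) (a : A), a ∈ 𝒜 n → α a ∈ 𝒜 n
  α_μ : ∀ a b : A, α (μ a b) = μ (α a) (α b)
  hom_assoc : ∀ a b c : A, μ (α a) (μ b c) = μ (μ a b) (α c)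
  α_d : ∀ a : A, α (d a) = d (α a)
  leibniz : ∀ (n : ℤ) (a b : A), a ∈ 𝒜 n →
    d (μ a b) = μ (d a) b + Int.negOnePow n • μ a (d b)

/-- A contraction `(p, i, h)` from the chain complex `(A, d_A)` to the chain complex `(H, d_H)`. -/
structure Contraction {K A H : Type*} [Field K] [AddCommGroup A] [Module K A]
    [AddCommGroup H] [Module K H] {𝒜 : ℤ → Submodule K A} {ℋ : ℤ → Submodule K H}
    (X : ChainCx 𝒜) (Y : ChainCx ℋ) where
  p : A →ₗ[K] H
  i : H →ₗ[K] A
  h : A →ₗ[K] A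
  p_mem : ∀ (n : ℤ) (a : A), a ∈ 𝒜 n → p a ∈ ℋ n
  i_mem : ∀ (n : ℤ) (x : H), x ∈ ℋ n → i x ∈ 𝒜 n
  h_mem : ∀ (n : ℤ) (a : A), a ∈ 𝒜 n → h a ∈ 𝒜 (n + 1)
  p_d : ∀ a : A, p (X.d a) = Y.d (p a)
  i_d : ∀ x : H, i (Y.d x) = X.d (i x)
  homotopy : ∀ a : A, a - i (p a) = X.d (h a) + h (X.d a)
  p_i : ∀ x : H, p (i x) = x

/-- An `HA_∞`-algebra structure on the graded vector space `V = ⨁ₙ 𝒱 n`: operations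
`μ k : V^{⊗k} → V` of degree `k - 2` for `k ≥ 1` (`μ 0` is set to zero and plays no role) and a
linear map `α` of degree `0` preserving all of them, subject to the identities

`∑_{i+j=n+1} ∑_{l=1}^{j} (-1)^{l(i+1) + i(|v₁|+⋯+|v_{l-1}|)}`
`μ_j (α^{i-1} v₁, …, α^{i-1} v_{l-1}, μ_i (v_l, …, v_{l+i-1}), α^{i-1} v_{l+i}, …, α^{i-1} v_n) = 0`

for all `n ≥ 1` and homogeneous `v₁, …, v_n`. Here a tuple is the beginning of a sequence
`v : ℕ → V`, numbered from `0` (so `v q` is the entry `v_{q+1}` above), of which only the first `n`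
entries are used. -/
structure HAInfinity {K V : Type*} [Field K] [AddCommGroup V] [Module K V]
    (𝒱 : ℤ → Submodule K V) where
  μ : (k : ℕ) → MultilinearMap K (fun _ : Fin k => V) V
  α : Module.End K V
  μ_zero : μ 0 = 0
  μ_mem : ∀ k : ℕ, 1 ≤ k → ∀ (e : Fin k → ℤ) (v : Fin k → V), (∀ q, v q ∈ 𝒱 (e q)) →
    μ k v ∈ 𝒱 ((∑ q, e q) + k - 2)
  α_mem : ∀ (n : ℤ) (v : V), v ∈ 𝒱 n → α v ∈ 𝒱 n
  α_μ : ∀ k : ℕ, 1 ≤ k → ∀ v : Fin k → V, α (μ k v) = μ k (fun q => α (v q))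
  relation : ∀ n : ℕ, 1 ≤ n → ∀ (e : ℕ → ℤ) (v : ℕ → V), (∀ q, v q ∈ 𝒱 (e q)) →
    ∑ i ∈ Finset.Icc 1 n, ∑ l ∈ Finset.Icc 1 (n + 1 - i),
      Int.negOnePow (l * (i + 1) + i * ∑ q ∈ Finset.range (l - 1), e q) •
        μ (n + 1 - i) (fun q =>
          if (q : ℕ) + 1 < l then (α ^ (i - 1)) (v q)
          else if (q : ℕ) + 1 = l then μ i (fun u => v (q + u))
          else (α ^ (i - 1)) (v (q + (i - 1)))) = 0

/-- `h ∘ μ_T` as a function of the value of `μ_T`, with the convention that it is the identity when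
`T` is the tree with a single leaf. -/
def applyHomotopy {A : Type*} (h : A → A) : BinaryTree Unit → A → A
  | BinaryTree.nil, a => a
  | BinaryTree.node _ _ _, a => h a

/-- The operation `μ_T` of a planar binary tree `T` with `k` leaves, evaluated at homogeneous
elements `a 0, …, a (k - 1)` of degrees `e 0, …, e (k - 1)` (later entries are not used):
for `T = L ∨ R`, where `L` has `i` and `R` has `j` leaves,

`μ_T = (-1)^{i(j+1)} μ (α^{j-1} ∘ h ∘ μ_L ⊗ α^{i-1} ∘ h ∘ μ_R)`.

The sign `(-1)^{(j-1)(e 0 + ⋯ + e (i-1))}` is the Koszul sign for evaluating this tensor product,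
as `α^{i-1} ∘ h ∘ μ_R` has degree `j - 1`. -/
def treeOp {K A : Type*} [Field K] [AddCommGroup A] [Module K A]
    (μ : A →ₗ[K] A →ₗ[K] A) (α : Module.End K A) (h : A →ₗ[K] A) :
    BinaryTree Unit → (ℕ → ℤ) → (ℕ → A) → A
  | BinaryTree.nil, _, a => a 0
  | BinaryTree.node _ L R, e, a =>
    let i := L.numLeaves
    let j := R.numLeaves
    Int.negOnePow (i * (j + 1) + (j - 1) * ∑ q ∈ Finset.range i, e q) •
      μ ((α ^ (j - 1)) (applyHomotopy h L (treeOp μ α h L e a)))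
        ((α ^ (i - 1)) (applyHomotopy h R
          (treeOp μ α h R (fun q => e (i + q)) (fun q => a (i + q)))))

/-- `μ_k^A`, the sum of `μ_T` over all planar binary trees with `k` leaves, that is, with `k - 1`
internal vertices (`k ≥ 2`). -/
def treeSum {K A : Type*} [Field K] [AddCommGroup A] [Module K A]
    (μ : A →ₗ[K] A →ₗ[K] A) (α : Module.End K A) (h : A →ₗ[K] A)
    (k : ℕ) (e : ℕ → ℤ) (a : ℕ → A) : A :=
  ∑ T ∈ BinaryTree.treesOfNumNodesEq (k - 1), treeOp μ α h T e a

open Finset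

/-! The transfer is carried out in suspended form, where the product `b = μ ∘ (σ ⊗ 1)`, twisted by
the parity `σ` of the shifted degree, has degree -1. Hom-associativity then says that the two ways
of composing `b` cancel, and all Koszul signs are powers of the operator `σ`, so the argument runs
over arbitrary elements.

The heart is `SuspendedData.d_treeOps`: the differential of the sum over trees equals minus the sum
over all ways of inserting `d`, or `P` of a smaller tree sum, at a leaf. Since `d` is a derivation
of `b`, it moves up the tree. At an internal edge `d η = P - 1 - η d`: the term with `P` cuts the
tree into an inner and an outer tree, the term with `η d` continues by induction, and the term with
`-1` contracts the edge. The contracted terms cancel in pairs by twisted associativity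
(`sum_properOps`); the powers of `α` in the tree operations are those that make this possible.

With `P = i ∘ p`, applying `p` outside and `i` inside turns this identity into the relations on `H`
(`suspendedOps_relation`). Two sign comparisons remain: `suspendedOps_insertAt` desuspends the
relations, and `ops_eq_treeSum` matches the suspended tree sums with the signed sums of the `μ_T`.
-/

/-- Reassociation of a sum over triples with a given sum. -/
theorem sum_antidiagonal_assoc {M : Type*} [AddCommMonoid M] (n : ℕ) (f : ℕ → ℕ → ℕ → M) :
    ∑ p ∈ antidiagonal n, ∑ q ∈ antidiagonal p.1, f q.1 q.2 p.2 =
      ∑ p ∈ antidiagonal n, ∑ q ∈ antidiagonal p.2, f p.1 q.1 q.2 := by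
  rw [Finset.sum_sigma', Finset.sum_sigma']
  refine Finset.sum_nbij' (fun x => ⟨(x.2.1, x.2.2 + x.1.2), (x.2.2, x.1.2)⟩)
    (fun x => ⟨(x.1.1 + x.2.1, x.2.2), (x.1.1, x.2.1)⟩) ?_ ?_ ?_ ?_ ?_
  · rintro ⟨⟨a, b⟩, c, d⟩ h
    simp only [mem_sigma, HasAntidiagonal.mem_antidiagonal] at h ⊢
    exact ⟨by omega, trivial⟩
  · rintro ⟨⟨a, b⟩, c, d⟩ h
    simp only [mem_sigma, HasAntidiagonal.mem_antidiagonal] at h ⊢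
    exact ⟨by omega, trivial⟩
  · rintro ⟨⟨a, b⟩, c, d⟩ h
    simp only [mem_sigma, HasAntidiagonal.mem_antidiagonal] at h
    obtain ⟨-, rfl⟩ := h
    rfl
  · rintro ⟨⟨a, b⟩, c, d⟩ h
    simp only [mem_sigma, HasAntidiagonal.mem_antidiagonal] at h
    obtain ⟨-, rfl⟩ := h
    rfl
  · rintro ⟨⟨a, b⟩, c, d⟩ h
    rfl

/-- Exchange of the first two entries in a sum over triples with a given sum. -/
theorem sum_antidiagonal_left_comm {M : Type*} [AddCommMonoid M] (n : ℕ) (f : ℕ → ℕ → ℕ → M) :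
    ∑ p ∈ antidiagonal n, ∑ q ∈ antidiagonal p.2, f p.1 q.1 q.2 =
      ∑ p ∈ antidiagonal n, ∑ q ∈ antidiagonal p.2, f q.1 p.1 q.2 := by
  rw [← sum_antidiagonal_assoc, ← sum_antidiagonal_assoc n fun a b c => f b a c]
  refine Finset.sum_congr rfl fun p _ => ?_
  rw [← Finset.Nat.sum_antidiagonal_swap]
  rfl

/-! ### Suspended data and insertion into sequences -/

/-- The data of homological perturbation for a twisted associative product in suspended form:
a differential `d`, a product `b` of degree `-1`, a twist `α`, the parity operator `σ`, a homotopy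
`η` and a map `P` with `d η + η d = P - 1`. -/
structure SuspendedData (K A : Type*) [Field K] [AddCommGroup A] [Module K A] where
  d : Module.End K A
  b : A →ₗ[K] A →ₗ[K] A
  α : Module.End K A
  σ : Module.End K A
  η : Module.End K A
  P : Module.End K A
  α_d : Commute α d
  α_σ : Commute α σ
  α_η : Commute α η
  α_b : ∀ x y, α (b x y) = b (α x) (α y)
  σ_η : ∀ x, σ (η x) = -η (σ x)
  σ_b : ∀ x y, σ (b x y) = -b (σ x) (σ y)
  d_b : ∀ x y, d (b x y) = -b (d x) y - b (σ x) (d y)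
  b_b : ∀ x y z, b (b x y) (α z) + b (σ (α x)) (b y z) = 0
  d_η : ∀ x, d (η x) = P x - x - η (d x)

/-- The application of `η`, except in the case of a single leaf. -/
def homotopyAbove {A : Type*} (η : A → A) : ℕ → A → A
  | 0, x => x
  | _ + 1, x => η x

/-- `i` consecutive entries of `v` starting with the `l`-th together with it are replaced by the
value of `w` on them; the entries before are changed by `pre` and those after by `post`. -/
def insertAt {V : Type*} (w : (ℕ → V) → V) (pre post : V → V) (i l : ℕ) (v : ℕ → V) : ℕ → V :=
  fun q => if q < l then pre (v q) else if q = l then w (fun u => v (l + u)) else post (v (q + i))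

section insertAt

variable {V : Type*} (w : (ℕ → V) → V) (pre post : V → V) (i l : ℕ) (v : ℕ → V)

theorem insertAt_zero_zero : insertAt w pre post i 0 v 0 = w v := by simp [insertAt]

theorem insertAt_of_lt {q : ℕ} (h : q < l) : insertAt w pre post i l v q = pre (v q) := by
  simp [insertAt, h]

theorem insertAt_shift_of_lt {r : ℕ} (h : l < r) :
    (fun q => insertAt w pre post i l v (r + q)) = fun q => post (v (r + i + q)) := by
  funext q
  rw [insertAt, if_neg (by omega), if_neg (by omega), Nat.add_right_comm]

theorem insertAt_shift_add (r : ℕ) :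
    (fun q => insertAt w pre post i (r + l) v (r + q)) =
      insertAt w pre post i l fun q => v (r + q) := by
  funext q
  simp only [insertAt, add_lt_add_iff_left, add_right_inj, add_assoc]

end insertAt

theorem update_shift {V : Type*} (v : ℕ → V) (q r : ℕ) (x : V) :
    (fun u => Function.update v (r + q) x (r + u)) = Function.update (fun u => v (r + u)) q x := by
  funext u
  by_cases h : u = q
  · subst h; simp
  · rw [Function.update_of_ne h, Function.update_of_ne (by omega)]

theorem update_shift_of_lt {V : Type*} (v : ℕ → V) {q r : ℕ} (h : q < r) (x : V) :
    (fun u => Function.update v q x (r + u)) = fun u => v (r + u) := by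
  funext u
  rw [Function.update_of_ne (by omega)]

theorem Commute.end_pow_apply {K A : Type*} [Field K] [AddCommGroup A] [Module K A]
    {f g : Module.End K A} (h : Commute f g) (n : ℕ) (x : A) : (f ^ n) (g x) = g ((f ^ n) x) :=
  LinearMap.congr_fun (h.pow_left n).eq x

theorem Module.End.pow_add_apply {K A : Type*} [Field K] [AddCommGroup A] [Module K A]
    (f : Module.End K A) (m n : ℕ) (x : A) : (f ^ m) ((f ^ n) x) = (f ^ (m + n)) x := by
  rw [pow_add]; rfl

/-! ### Tree sums in suspended form -/

namespace SuspendedData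

variable {K A : Type*} [Field K] [AddCommGroup A] [Module K A] (D : SuspendedData K A)

/-- The sum over all planar binary trees with `n` internal vertices of the operations in which
the vertices are products and the internal edges are homotopies. -/
def treeOps : ℕ → (ℕ → A) → A
  | 0, v => v 0
  | m + 1, v => ∑ x ∈ (antidiagonal m).attach,
      D.b ((D.α ^ x.1.2) (homotopyAbove D.η x.1.1 (treeOps x.1.1 v)))
        ((D.α ^ x.1.1) (homotopyAbove D.η x.1.2 (treeOps x.1.2 fun q => v (x.1.1 + 1 + q))))
  decreasing_by
    · have := mem_antidiagonal.1 x.2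
      omega
    · have := mem_antidiagonal.1 x.2
      omega

/-- `treeOps` followed by the homotopy, except in the case of a single leaf. -/
def rootedOps (n : ℕ) (v : ℕ → A) : A := homotopyAbove D.η n (D.treeOps n v)

@[simp] theorem rootedOps_zero (v : ℕ → A) : D.rootedOps 0 v = v 0 := by
  simp [rootedOps, homotopyAbove, treeOps]

theorem rootedOps_succ (n : ℕ) (v : ℕ → A) :
    D.rootedOps (n + 1) v = D.η (D.treeOps (n + 1) v) := rfl

theorem treeOps_succ (m : ℕ) (v : ℕ → A) : D.treeOps (m + 1) v = ∑ x ∈ antidiagonal m,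
    D.b ((D.α ^ x.2) (D.rootedOps x.1 v))
      ((D.α ^ x.1) (D.rootedOps x.2 fun q => v (x.1 + 1 + q))) := by
  rw [treeOps, ← Finset.sum_attach (antidiagonal m)]
  rfl

/-- Induction on the number of vertices for statements on `treeOps` and `rootedOps`. -/
theorem ops_induction {p : ℕ → Prop} {p' : ℕ → Prop} (h0 : p 0) (hg : ∀ n, p' n → p (n + 1))
    (hf : ∀ n, (∀ m ≤ n, p m) → p' n) (n : ℕ) : p n ∧ p' n := by
  have key : ∀ n, ∀ m ≤ n, p m := by
    intro n
    induction n with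
    | zero => intro m hm; rwa [Nat.le_zero.1 hm]
    | succ n ih =>
      intro m hm
      rcases Nat.lt_or_eq_of_le hm with h | rfl
      · exact ih m (by omega)
      · exact hg n (hf n ih)
  exact ⟨key n n le_rfl, hf n (key n)⟩

/-- Operations take infinite sequences, so that subtrees can be fed by shifting the index; this is
the locality that makes the choice of the later entries irrelevant. -/
theorem ops_congr (n : ℕ) :
    (∀ v w : ℕ → A, (∀ q ≤ n, v q = w q) → D.rootedOps n v = D.rootedOps n w) ∧
    (∀ v w : ℕ → A, (∀ q ≤ n + 1, v q = w q) → D.treeOps (n + 1) v = D.treeOps (n + 1) w) := by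
  refine ops_induction (p := fun n => ∀ v w : ℕ → A, (∀ q ≤ n, v q = w q) →
    D.rootedOps n v = D.rootedOps n w) (p' := fun n => ∀ v w : ℕ → A,
    (∀ q ≤ n + 1, v q = w q) → D.treeOps (n + 1) v = D.treeOps (n + 1) w) ?_ ?_ ?_ n
  · intro v w h
    simpa using h 0 le_rfl
  · intro n h v w hvw
    rw [rootedOps_succ, rootedOps_succ, h v w hvw]
  · intro n h v w hvw
    rw [treeOps_succ, treeOps_succ]
    refine Finset.sum_congr rfl fun x hx => ?_
    have hx := mem_antidiagonal.1 hx
    rw [h x.1 (by omega) v w fun q hq => hvw q (by omega),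
      h x.2 (by omega) (fun q => v (x.1 + 1 + q)) (fun q => w (x.1 + 1 + q))
        fun q hq => hvw _ (by omega)]

theorem rootedOps_congr {n : ℕ} {v w : ℕ → A} (h : ∀ q ≤ n, v q = w q) :
    D.rootedOps n v = D.rootedOps n w := (D.ops_congr n).1 v w h

theorem treeOps_congr {n : ℕ} {v w : ℕ → A} (h : ∀ q ≤ n, v q = w q) :
    D.treeOps n v = D.treeOps n w := by
  cases n with
  | zero => simpa [treeOps] using h 0 le_rfl
  | succ n => exact (D.ops_congr n).2 v w h

theorem ops_α (n : ℕ) :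
    (∀ v : ℕ → A, D.rootedOps n (fun q => D.α (v q)) = D.α (D.rootedOps n v)) ∧
    (∀ v : ℕ → A, D.treeOps (n + 1) (fun q => D.α (v q)) = D.α (D.treeOps (n + 1) v)) := by
  refine ops_induction
    (p := fun n => ∀ v : ℕ → A, D.rootedOps n (fun q => D.α (v q)) = D.α (D.rootedOps n v))
    (p' := fun n => ∀ v : ℕ → A,
      D.treeOps (n + 1) (fun q => D.α (v q)) = D.α (D.treeOps (n + 1) v)) ?_ ?_ ?_ n
  · intro v
    simp
  · intro n h v
    rw [rootedOps_succ, rootedOps_succ, h]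
    exact (LinearMap.congr_fun D.α_η.eq _).symm
  · intro n h v
    rw [treeOps_succ, treeOps_succ, map_sum]
    refine Finset.sum_congr rfl fun x hx => ?_
    have hx := mem_antidiagonal.1 hx
    rw [h x.1 (by omega), h x.2 (by omega) (fun q => v (x.1 + 1 + q)), D.α_b,
      (Commute.refl D.α).end_pow_apply, (Commute.refl D.α).end_pow_apply]

theorem rootedOps_α_pow (n i : ℕ) (v : ℕ → A) :
    D.rootedOps n (fun q => (D.α ^ i) (v q)) = (D.α ^ i) (D.rootedOps n v) := by
  induction i with
  | zero => simp
  | succ i ih =>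
    simp only [pow_succ', Module.End.mul_apply]
    rw [(D.ops_α n).1 fun q => (D.α ^ i) (v q), ih]

/-- Each product contributes a sign and each homotopy another. A rooted operation has equally many
of both, an unrooted one has one product more. -/
theorem ops_σ (n : ℕ) :
    (∀ v : ℕ → A, D.rootedOps n (fun q => D.σ (v q)) = D.σ (D.rootedOps n v)) ∧
    (∀ v : ℕ → A, D.treeOps (n + 1) (fun q => D.σ (v q)) = -D.σ (D.treeOps (n + 1) v)) := by
  refine ops_induction
    (p := fun n => ∀ v : ℕ → A, D.rootedOps n (fun q => D.σ (v q)) = D.σ (D.rootedOps n v))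
    (p' := fun n => ∀ v : ℕ → A,
      D.treeOps (n + 1) (fun q => D.σ (v q)) = -D.σ (D.treeOps (n + 1) v)) ?_ ?_ ?_ n
  · intro v
    simp
  · intro n h v
    rw [rootedOps_succ, rootedOps_succ, h, D.σ_η, map_neg]
  · intro n h v
    rw [treeOps_succ, treeOps_succ, map_sum, ← Finset.sum_neg_distrib]
    refine Finset.sum_congr rfl fun x hx => ?_
    have hx := mem_antidiagonal.1 hx
    rw [h x.1 (by omega), h x.2 (by omega) (fun q => v (x.1 + 1 + q)), D.σ_b,
      D.α_σ.end_pow_apply, D.α_σ.end_pow_apply, neg_neg]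

theorem rootedOps_σ_pow (n i : ℕ) (v : ℕ → A) :
    D.rootedOps n (fun q => (D.σ ^ i) (v q)) = (D.σ ^ i) (D.rootedOps n v) := by
  induction i with
  | zero => simp
  | succ i ih =>
    simp only [pow_succ', Module.End.mul_apply]
    rw [(D.ops_σ n).1 fun q => (D.σ ^ i) (v q), ih]

/-- Multilinearity, one slot at a time: a given leaf lies in exactly one of the two subtrees at the
root, and the other factor stays constant. -/
theorem ops_update (n : ℕ) :
    (∀ (v : ℕ → A) (q : ℕ), q ≤ n → ∃ L : A →ₗ[K] A, ∀ x,
      D.rootedOps n (Function.update v q x) = L x) ∧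
    (∀ (v : ℕ → A) (q : ℕ), q ≤ n + 1 → ∃ L : A →ₗ[K] A, ∀ x,
      D.treeOps (n + 1) (Function.update v q x) = L x) := by
  refine ops_induction (p := fun n => ∀ (v : ℕ → A) (q : ℕ), q ≤ n → ∃ L : A →ₗ[K] A, ∀ x,
      D.rootedOps n (Function.update v q x) = L x)
    (p' := fun n => ∀ (v : ℕ → A) (q : ℕ), q ≤ n + 1 → ∃ L : A →ₗ[K] A, ∀ x,
      D.treeOps (n + 1) (Function.update v q x) = L x) ?_ ?_ ?_ n
  · intro v q hq
    obtain rfl : q = 0 := by omega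
    exact ⟨LinearMap.id, fun x => by simp⟩
  · intro n h v q hq
    obtain ⟨L, hL⟩ := h v q hq
    exact ⟨D.η ∘ₗ L, fun x => by rw [rootedOps_succ, hL]; rfl⟩
  · intro n h v q hq
    have key : ∀ x : ℕ × ℕ, x ∈ antidiagonal n → ∃ L : A →ₗ[K] A, ∀ y,
        D.b ((D.α ^ x.2) (D.rootedOps x.1 (Function.update v q y)))
          ((D.α ^ x.1) (D.rootedOps x.2 fun u => Function.update v q y (x.1 + 1 + u))) = L y := by
      intro x hx
      have hx := mem_antidiagonal.1 hx
      by_cases hq' : q ≤ x.1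
      · obtain ⟨L, hL⟩ := h x.1 (by omega) v q hq'
        refine ⟨D.b.flip ((D.α ^ x.1) (D.rootedOps x.2 fun u => v (x.1 + 1 + u))) ∘ₗ
          (D.α ^ x.2) ∘ₗ L, fun y => ?_⟩
        rw [hL, update_shift_of_lt v (by omega)]
        rfl
      · obtain ⟨t, rfl⟩ : ∃ t, q = x.1 + 1 + t := ⟨q - (x.1 + 1), by omega⟩
        obtain ⟨L, hL⟩ := h x.2 (by omega) (fun u => v (x.1 + 1 + u)) t (by omega)
        refine ⟨D.b ((D.α ^ x.2) (D.rootedOps x.1 v)) ∘ₗ (D.α ^ x.1) ∘ₗ L, fun y => ?_⟩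
        rw [update_shift, hL, D.rootedOps_congr (w := v)
          fun u hu => Function.update_of_ne (by omega) _ _]
        rfl
    choose L hL using key
    refine ⟨∑ x ∈ (antidiagonal n).attach, L x.1 x.2, fun y => ?_⟩
    rw [treeOps_succ, ← Finset.sum_attach, LinearMap.sum_apply]
    exact Finset.sum_congr rfl fun x _ => hL x.1 x.2 y

/-! ### The differential of the tree sum -/

/-- The operation of arity `i + 1` that is inserted: the differential for `i = 0`, and the
projected sum over trees for `i > 0`. -/
def inner : ℕ → (ℕ → A) → A
  | 0, v => D.d (v 0)
  | i + 1, v => D.P (D.treeOps (i + 1) v)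

/-- The sequence obtained from `v` by the insertion of `inner i` at the `l`-th place. -/
def ins (i l : ℕ) (v : ℕ → A) : ℕ → A :=
  insertAt (D.inner i) (fun x => D.σ ((D.α ^ i) x)) (fun x => (D.α ^ i) x) i l v

/-- The sum over trees, without the contribution of the tree with a single leaf. -/
def properOps : ℕ → (ℕ → A) → A
  | 0, _ => 0
  | i + 1, v => D.treeOps (i + 1) v

/-- All leaves of this subtree lie to the left of the insertion, so they only see the prefix map,
which passes through the operation. -/
theorem rootedOps_ins_add (r i l : ℕ) (v : ℕ → A) :
    D.rootedOps r (D.ins i (r + 1 + l) v) = D.σ ((D.α ^ i) (D.rootedOps r v)) := by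
  rw [D.rootedOps_congr (w := fun q => D.σ ((D.α ^ i) (v q)))
    fun q hq => insertAt_of_lt _ _ _ _ _ _ (by omega),
    (D.ops_σ r).1 fun q => (D.α ^ i) (v q), rootedOps_α_pow]

theorem α_pow_b (n : ℕ) (x y : A) : (D.α ^ n) (D.b x y) = D.b ((D.α ^ n) x) ((D.α ^ n) y) := by
  induction n with
  | zero => simp
  | succ n ih => simp only [pow_succ', Module.End.mul_apply, ih, D.α_b]

/-- These are the terms in which an edge at the root has been contracted. Splitting the proper
factor at its own root, both halves become sums over triples of subtrees, and the two bracketings of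
each triple cancel by `b_b`. -/
theorem sum_properOps (n : ℕ) (v : ℕ → A) :
    ∑ x ∈ antidiagonal n,
      (D.b ((D.α ^ x.2) (D.properOps x.1 v))
          ((D.α ^ x.1) (D.rootedOps x.2 fun q => v (x.1 + 1 + q))) +
        D.b (D.σ ((D.α ^ x.2) (D.rootedOps x.1 v)))
          ((D.α ^ x.1) (D.properOps x.2 fun q => v (x.1 + 1 + q)))) = 0 := by
  rw [Finset.sum_add_distrib]
  cases n with
  | zero => simp [properOps]
  | succ n =>
    rw [Finset.Nat.sum_antidiagonal_succ, Finset.Nat.sum_antidiagonal_succ']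
    simp only [properOps, map_zero, LinearMap.zero_apply, zero_add, treeOps_succ, map_sum,
      LinearMap.sum_apply]
    -- Writes `x.1` as `y.1 + y.2`, so that the summand depends on the triple alone and the sums can
    -- be reassociated.
    have h : ∀ x ∈ antidiagonal n, ∀ y ∈ antidiagonal x.1,
        D.b ((D.α ^ x.2) (D.b ((D.α ^ y.2) (D.rootedOps y.1 v))
          ((D.α ^ y.1) (D.rootedOps y.2 fun q => v (y.1 + 1 + q)))))
          ((D.α ^ (x.1 + 1)) (D.rootedOps x.2 fun q => v (x.1 + 1 + 1 + q))) =
        D.b ((D.α ^ x.2) (D.b ((D.α ^ y.2) (D.rootedOps y.1 v))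
          ((D.α ^ y.1) (D.rootedOps y.2 fun q => v (y.1 + 1 + q)))))
          ((D.α ^ (y.1 + y.2 + 1)) (D.rootedOps x.2 fun q => v (y.1 + y.2 + 1 + 1 + q))) := by
      intro x _ y hy
      rw [HasAntidiagonal.mem_antidiagonal.1 hy]
    rw [Finset.sum_congr rfl fun x hx => Finset.sum_congr rfl (h x hx),
      sum_antidiagonal_assoc n fun a b c =>
      D.b ((D.α ^ c) (D.b ((D.α ^ b) (D.rootedOps a v))
        ((D.α ^ a) (D.rootedOps b fun q => v (a + 1 + q)))))
        ((D.α ^ (a + b + 1)) (D.rootedOps c fun q => v (a + b + 1 + 1 + q))),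
      ← Finset.sum_add_distrib]
    refine Finset.sum_eq_zero fun x _ => ?_
    rw [← Finset.sum_add_distrib]
    refine Finset.sum_eq_zero fun y hy => ?_
    obtain ⟨a, m⟩ := x
    obtain ⟨b, c⟩ := y
    obtain rfl : b + c = m := HasAntidiagonal.mem_antidiagonal.1 hy
    have e : (fun q => v (a + 1 + (b + 1 + q))) = fun q => v (a + b + 1 + 1 + q) := by
      funext q
      congr 1
      omega
    simp only [e, α_pow_b, Module.End.pow_add_apply]
    -- For subtrees with `a`, `b`, `c` vertices, both bracketings carry `α` to the powers `b + c`,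
    -- `a + c`, `a + b` on the three factors, plus the one extra `α` required by `b_b` on an outer
    -- factor.
    rw [add_comm (a + b) 1, ← Module.End.pow_add_apply D.α 1, add_comm (b + c) 1,
      ← Module.End.pow_add_apply D.α 1, pow_one, add_comm c b, add_comm c a]
    exact D.b_b _ _ _

/-- From `d η = P - 1 - η d`: the `P` term is the insertion into the one-leaf tree, the `η d` term
gives the insertions into larger trees, and the `-1` term is the leftover `properOps`. -/
theorem d_rootedOps_succ (n : ℕ) (v : ℕ → A)
    (h : D.d (D.treeOps (n + 1) v) = -∑ x ∈ antidiagonal n, ∑ l ∈ range (x.2 + 2),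
      D.treeOps (x.2 + 1) (D.ins x.1 l v)) :
    D.d (D.rootedOps (n + 1) v) = ∑ x ∈ antidiagonal (n + 1), ∑ l ∈ range (x.2 + 1),
      D.rootedOps x.2 (D.ins x.1 l v) + -D.properOps (n + 1) v := by
  rw [Finset.Nat.sum_antidiagonal_succ', rootedOps_succ, D.d_η, h]
  simp only [rootedOps_succ, map_neg, map_sum, zero_add, range_one, sum_singleton, rootedOps_zero,
    properOps, ins, insertAt_zero_zero, inner]
  abel

/-- The derivation rule sends `d` into the left or the right subtree, and an insertion likewise hits
a leaf of one of them. In `X` and `Y` the indices `i`, `j`, `s` count the vertices of the inserted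
tree and of the outer left and right subtrees. -/
theorem d_treeOps_succ (n : ℕ) (v : ℕ → A)
    (h : ∀ m ≤ n, ∀ v : ℕ → A, D.d (D.rootedOps m v) = ∑ x ∈ antidiagonal m,
      ∑ l ∈ range (x.2 + 1), D.rootedOps x.2 (D.ins x.1 l v) + -D.properOps m v) :
    D.d (D.treeOps (n + 1) v) = -∑ x ∈ antidiagonal n, ∑ l ∈ range (x.2 + 2),
      D.treeOps (x.2 + 1) (D.ins x.1 l v) := by
  let X : ℕ → ℕ → ℕ → A := fun i j s => ∑ l ∈ range (j + 1),
    D.b ((D.α ^ s) (D.rootedOps j (D.ins i l v)))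
      ((D.α ^ (i + j)) (D.rootedOps s fun q => v (i + j + 1 + q)))
  let Y : ℕ → ℕ → ℕ → A := fun i j s => ∑ l ∈ range (s + 1),
    D.b (D.σ ((D.α ^ (i + s)) (D.rootedOps j v)))
      ((D.α ^ j) (D.rootedOps s (D.ins i l fun q => v (j + 1 + q))))
  have hR : ∑ x ∈ antidiagonal n, ∑ l ∈ range (x.2 + 2), D.treeOps (x.2 + 1) (D.ins x.1 l v) =
      ∑ x ∈ antidiagonal n, ∑ y ∈ antidiagonal x.2, (X x.1 y.1 y.2 + Y x.1 y.1 y.2) := by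
    refine Finset.sum_congr rfl fun x _ => ?_
    simp only [treeOps_succ]
    rw [Finset.sum_comm]
    refine Finset.sum_congr rfl fun y hy => ?_
    have hy : y.1 + y.2 = x.2 := HasAntidiagonal.mem_antidiagonal.1 hy
    -- The first `y.1 + 1` positions are leaves of the left subtree, the remaining `y.2 + 1` leaves
    -- of the right one.
    rw [show x.2 + 2 = y.1 + 1 + (y.2 + 1) by omega, Finset.sum_range_add]
    congr 1
    · refine Finset.sum_congr rfl fun l hl => ?_
      have hl := Finset.mem_range.1 hl
      have e : (fun q => D.ins x.1 l v (y.1 + 1 + q)) =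
          fun q => (D.α ^ x.1) (v (x.1 + y.1 + 1 + q)) := by
        rw [show x.1 + y.1 + 1 = y.1 + 1 + x.1 by omega]
        exact insertAt_shift_of_lt _ _ _ _ _ _ hl
      rw [e, D.rootedOps_α_pow y.2 x.1 fun q => v (x.1 + y.1 + 1 + q), Module.End.pow_add_apply,
        add_comm y.1 x.1]
    · refine Finset.sum_congr rfl fun l _ => ?_
      rw [rootedOps_ins_add, D.α_σ.end_pow_apply, Module.End.pow_add_apply, add_comm y.2 x.1]
      congr 3
      exact insertAt_shift_add _ _ _ _ _ _ _
  have hL1 : ∑ x ∈ antidiagonal n, ∑ y ∈ antidiagonal x.1, X y.1 y.2 x.2 =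
      ∑ x ∈ antidiagonal n, D.b ((D.α ^ x.2) (∑ y ∈ antidiagonal x.1,
        ∑ l ∈ range (y.2 + 1), D.rootedOps y.2 (D.ins y.1 l v)))
        ((D.α ^ x.1) (D.rootedOps x.2 fun q => v (x.1 + 1 + q))) := by
    refine Finset.sum_congr rfl fun x _ => ?_
    simp only [map_sum, LinearMap.sum_apply]
    refine Finset.sum_congr rfl fun y hy => ?_
    simp only [X, HasAntidiagonal.mem_antidiagonal.1 hy]
  have hL2 : ∑ x ∈ antidiagonal n, ∑ y ∈ antidiagonal x.2, Y y.1 x.1 y.2 =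
      ∑ x ∈ antidiagonal n, D.b (D.σ ((D.α ^ x.2) (D.rootedOps x.1 v)))
        ((D.α ^ x.1) (∑ y ∈ antidiagonal x.2, ∑ l ∈ range (y.2 + 1),
          D.rootedOps y.2 (D.ins y.1 l fun q => v (x.1 + 1 + q)))) := by
    refine Finset.sum_congr rfl fun x _ => ?_
    simp only [map_sum]
    refine Finset.sum_congr rfl fun y hy => ?_
    simp only [Y, HasAntidiagonal.mem_antidiagonal.1 hy]
  have hp := D.sum_properOps n v
  rw [hR]
  simp only [Finset.sum_add_distrib] at hp ⊢
  -- The vanishing sum `hp` is added in order to absorb the leftover terms with `properOps`.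
  rw [← sum_antidiagonal_assoc n X, sum_antidiagonal_left_comm n Y, hL1, hL2, treeOps_succ,
    map_sum, ← add_zero (-_), ← hp, neg_add]
  simp only [← Finset.sum_neg_distrib, ← Finset.sum_add_distrib]
  refine Finset.sum_congr rfl fun x hx => ?_
  have hx := mem_antidiagonal.1 hx
  rw [D.d_b, ← D.α_d.end_pow_apply, ← D.α_d.end_pow_apply, h x.1 (by omega), h x.2 (by omega)]
  simp only [map_add, map_neg, LinearMap.add_apply, LinearMap.neg_apply]
  abel

theorem d_treeOps (n : ℕ) (v : ℕ → A) :
    D.d (D.treeOps (n + 1) v) + ∑ x ∈ antidiagonal n, ∑ l ∈ range (x.2 + 2),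
      D.treeOps (x.2 + 1) (D.ins x.1 l v) = 0 := by
  rw [add_eq_zero_iff_eq_neg]
  refine (ops_induction
    (p := fun m => ∀ v : ℕ → A, D.d (D.rootedOps m v) = ∑ x ∈ antidiagonal m,
      ∑ l ∈ range (x.2 + 1), D.rootedOps x.2 (D.ins x.1 l v) + -D.properOps m v)
    (p' := fun n => ∀ v : ℕ → A, D.d (D.treeOps (n + 1) v) =
      -∑ x ∈ antidiagonal n, ∑ l ∈ range (x.2 + 2), D.treeOps (x.2 + 1) (D.ins x.1 l v))
    ?_ (fun n h v => D.d_rootedOps_succ n v (h v)) (fun n h v => D.d_treeOps_succ n v h) n).2 v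
  intro v
  simp [properOps, ins, insertAt, inner]

end SuspendedData

/-! ### Signs and the parity operator -/

theorem map_intUnits_smul {K A B : Type*} [Field K] [AddCommGroup A] [Module K A] [AddCommGroup B]
    [Module K B] (f : A →ₗ[K] B) (u : ℤˣ) (x : A) : f (u • x) = u • f x := by
  rw [Units.smul_def, map_zsmul, Units.smul_def]

theorem Submodule.intUnits_smul_mem {K A : Type*} [Field K] [AddCommGroup A] [Module K A]
    (S : Submodule K A) (u : ℤˣ) {x : A} (h : x ∈ S) : u • x ∈ S := by
  rw [Units.smul_def]
  exact zsmul_mem h _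

theorem Int.negOnePow_congr {m n : ℤ} (h : ∃ k, m - n = 2 * k) : m.negOnePow = n.negOnePow := by
  rw [Int.negOnePow_eq_iff]
  obtain ⟨k, hk⟩ := h
  exact ⟨k, by rw [hk, two_mul]⟩

section parity

variable {K A B : Type*} [Field K] [AddCommGroup A] [Module K A] [AddCommGroup B] [Module K B]
  (𝒜 : ℤ → Submodule K A) [DirectSum.Decomposition 𝒜]
  (ℬ : ℤ → Submodule K B) [DirectSum.Decomposition ℬ]

/-- The multiplication with the sign of the suspended degree. -/
def suspParity : Module.End K A :=
  DirectSum.toModule K ℤ A (fun n => ((n + 1).negOnePow : ℤ) • (𝒜 n).subtype) ∘ₗ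
    (DirectSum.decomposeLinearEquiv 𝒜).toLinearMap

variable {𝒜 ℬ}

theorem suspParity_of_mem {n : ℤ} {a : A} (h : a ∈ 𝒜 n) :
    suspParity 𝒜 a = (n + 1).negOnePow • a := by
  have : DirectSum.decompose 𝒜 a = DirectSum.lof K ℤ (fun i => 𝒜 i) n ⟨a, h⟩ :=
    DirectSum.decompose_of_mem 𝒜 h
  rw [suspParity, LinearMap.comp_apply, LinearEquiv.coe_coe, DirectSum.decomposeLinearEquiv_apply,
    this, DirectSum.toModule_lof, LinearMap.smul_apply, Submodule.subtype_apply, Units.smul_def]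

theorem suspParity_mem {n : ℤ} {a : A} (h : a ∈ 𝒜 n) : suspParity 𝒜 a ∈ 𝒜 n := by
  rw [suspParity_of_mem h]
  exact Submodule.intUnits_smul_mem _ _ h

theorem suspParity_pow_of_mem {n : ℤ} {a : A} (h : a ∈ 𝒜 n) (k : ℕ) :
    (suspParity 𝒜 ^ k) a = (k * (n + 1)).negOnePow • a := by
  induction k with
  | zero => simp
  | succ k ih =>
    rw [pow_succ', Module.End.mul_apply, ih, map_intUnits_smul, suspParity_of_mem h, smul_smul,
      ← Int.negOnePow_add]
    congr 2
    push_cast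
    ring

theorem suspParity_pow_mem {n : ℤ} {a : A} (h : a ∈ 𝒜 n) (k : ℕ) :
    (suspParity 𝒜 ^ k) a ∈ 𝒜 n := by
  rw [suspParity_pow_of_mem h]
  exact Submodule.intUnits_smul_mem _ _ h

variable (𝒜) in
theorem linearMap_ext_of_mem {f g : A →ₗ[K] B} (h : ∀ (n : ℤ) (a : A), a ∈ 𝒜 n → f a = g a) :
    f = g := by
  ext a
  induction a using DirectSum.Decomposition.inductionOn 𝒜 with
  | zero => simp
  | homogeneous a => exact h _ _ a.2
  | add a b ha hb => rw [map_add, map_add, ha, hb]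

variable (𝒜) in
theorem suspParity_suspParity (a : A) : suspParity 𝒜 (suspParity 𝒜 a) = a := by
  refine LinearMap.congr_fun (f := suspParity 𝒜 ∘ₗ suspParity 𝒜) (g := LinearMap.id)
    (linearMap_ext_of_mem 𝒜 fun n a h => ?_) a
  rw [LinearMap.comp_apply, suspParity_of_mem (suspParity_mem h), suspParity_of_mem h, smul_smul,
    Int.units_mul_self, one_smul, LinearMap.id_apply]

/-- A homogeneous map of degree `k` commutes with the parity up to the sign of `k`. -/
theorem map_suspParity (f : A →ₗ[K] B) (k : ℤ) (hf : ∀ n a, a ∈ 𝒜 n → f a ∈ ℬ (n + k)) (a : A) :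
    f (suspParity 𝒜 a) = k.negOnePow • suspParity ℬ (f a) := by
  have : f ∘ₗ suspParity 𝒜 = (k.negOnePow : ℤ) • (suspParity ℬ ∘ₗ f) := by
    refine linearMap_ext_of_mem 𝒜 fun n a h => ?_
    rw [LinearMap.comp_apply, LinearMap.smul_apply, LinearMap.comp_apply, suspParity_of_mem h,
      suspParity_of_mem (hf n a h), map_intUnits_smul, ← Units.smul_def, smul_smul,
      ← Int.negOnePow_add]
    congr 1
    exact Int.negOnePow_congr ⟨-k, by ring⟩
  exact LinearMap.congr_fun this a

theorem map_suspParity_of_degree_zero (f : A →ₗ[K] B) (hf : ∀ n a, a ∈ 𝒜 n → f a ∈ ℬ n) (a : A) :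
    f (suspParity 𝒜 a) = suspParity ℬ (f a) := by
  rw [map_suspParity (ℬ := ℬ) f 0 (by simpa using hf), Int.negOnePow_zero, one_smul]

theorem map_suspParity_pow_of_degree_zero (f : A →ₗ[K] B) (hf : ∀ n a, a ∈ 𝒜 n → f a ∈ ℬ n)
    (k : ℕ) (a : A) : f ((suspParity 𝒜 ^ k) a) = (suspParity ℬ ^ k) (f a) := by
  induction k with
  | zero => simp
  | succ k ih =>
    rw [pow_succ', pow_succ', Module.End.mul_apply, Module.End.mul_apply, ← ih,
      map_suspParity_of_degree_zero f hf]

end parity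

namespace DGHomAssoc

variable {K A : Type*} [Field K] [AddCommGroup A] [Module K A]
  {𝒜 : ℤ → Submodule K A} [DirectSum.Decomposition 𝒜] (X : DGHomAssoc 𝒜)

theorem suspParity_μ (x y : A) :
    suspParity 𝒜 (X.μ x y) = -X.μ (suspParity 𝒜 x) (suspParity 𝒜 y) := by
  have : X.μ.compr₂ (suspParity 𝒜) = -X.μ.compl₁₂ (suspParity 𝒜) (suspParity 𝒜) := by
    refine linearMap_ext_of_mem 𝒜 fun m x hx => linearMap_ext_of_mem 𝒜 fun n y hy => ?_
    simp only [LinearMap.compr₂_apply, LinearMap.neg_apply, LinearMap.compl₁₂_apply]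
    rw [suspParity_of_mem (X.μ_mem m n x y hx hy), suspParity_of_mem hx, suspParity_of_mem hy,
      map_intUnits_smul, map_intUnits_smul, Units.smul_def, Units.smul_def, Units.smul_def,
      LinearMap.smul_apply, smul_smul, ← neg_smul, ← Units.val_mul, ← Int.negOnePow_add,
      ← Units.val_neg, ← Int.negOnePow_succ]
    congr 2
    exact Int.negOnePow_congr ⟨-1, by ring⟩
  exact LinearMap.congr_fun₂ this x y

/-- The Leibniz rule freed from homogeneity. The minus sign appears because `suspParity` counts the
degree plus one. -/
theorem d_μ (x y : A) : X.d (X.μ x y) = X.μ (X.d x) y - X.μ (suspParity 𝒜 x) (X.d y) := by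
  have : X.μ.compr₂ X.d = X.μ ∘ₗ X.d - X.μ.compl₁₂ (suspParity 𝒜) X.d := by
    refine linearMap_ext_of_mem 𝒜 fun m x hx => LinearMap.ext fun y => ?_
    simp only [LinearMap.compr₂_apply, LinearMap.sub_apply, LinearMap.compl₁₂_apply,
      LinearMap.comp_apply]
    rw [X.leibniz m x y hx, suspParity_of_mem hx, map_intUnits_smul, Int.negOnePow_succ,
      Units.smul_def, Units.smul_def, LinearMap.smul_apply, Units.val_neg, neg_smul,
      sub_neg_eq_add]
  exact LinearMap.congr_fun₂ this x y

end DGHomAssoc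

namespace ChainCx

variable {K A : Type*} [Field K] [AddCommGroup A] [Module K A]
  {𝒜 : ℤ → Submodule K A} [DirectSum.Decomposition 𝒜] (X : ChainCx 𝒜)

theorem suspParity_d (x : A) : suspParity 𝒜 (X.d x) = -X.d (suspParity 𝒜 x) := by
  rw [map_suspParity (ℬ := 𝒜) X.d (-1) X.d_mem x]
  simp

end ChainCx

/-! ### The transferred twist and the suspended data of a contraction -/

namespace Contraction

variable {K A H : Type*} [Field K] [AddCommGroup A] [Module K A] [AddCommGroup H] [Module K H]
  {𝒜 : ℤ → Submodule K A} {ℋ : ℤ → Submodule K H}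
  {X : DGHomAssoc 𝒜} {Y : ChainCx ℋ} (c : Contraction X.toChainCx Y)

/-- `i ∘ p` is `1 - d h - h d`, and `α` commutes with `d` and `h`. Hence `i` and `p` intertwine `α`
with the transferred twist. -/
theorem α_i_p (hα : ∀ a : A, X.α (c.h a) = c.h (X.α a)) (a : A) : X.α (c.i (c.p a)) = c.i (c.p (X.α a)) := by
  have h1 := c.homotopy (X.α a)
  rw [← hα, ← X.α_d, ← X.α_d, ← hα, ← map_add, ← c.homotopy a, map_sub] at h1
  exact (sub_right_inj.1 h1).symm

/-- The twist transferred along a contraction. -/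
def transferredTwist : Module.End K H := c.p ∘ₗ X.α ∘ₗ c.i

theorem i_transferredTwist (hα : ∀ a : A, X.α (c.h a) = c.h (X.α a)) (x : H) :
    c.i (c.transferredTwist x) = X.α (c.i x) := by
  simp only [transferredTwist, LinearMap.comp_apply]
  rw [← c.α_i_p hα, c.p_i]

theorem transferredTwist_p (hα : ∀ a : A, X.α (c.h a) = c.h (X.α a)) (a : A) :
    c.transferredTwist (c.p a) = c.p (X.α a) := by
  simp only [transferredTwist, LinearMap.comp_apply]
  rw [c.α_i_p hα, c.p_i]

theorem i_transferredTwist_pow (hα : ∀ a : A, X.α (c.h a) = c.h (X.α a)) (k : ℕ) (x : H) :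
    c.i ((c.transferredTwist ^ k) x) = (X.α ^ k) (c.i x) := by
  induction k with
  | zero => simp
  | succ k ih => rw [pow_succ', pow_succ', Module.End.mul_apply, Module.End.mul_apply,
      c.i_transferredTwist hα, ih]

theorem transferredTwist_d (hα : ∀ a : A, X.α (c.h a) = c.h (X.α a)) (x : H) :
    c.transferredTwist (Y.d x) = Y.d (c.transferredTwist x) := by
  rw [← c.p_i x, ← c.p_d, c.transferredTwist_p hα, c.transferredTwist_p hα, X.α_d, c.p_d]

theorem transferredTwist_mem (n : ℤ) (x : H) (hx : x ∈ ℋ n) : c.transferredTwist x ∈ ℋ n :=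
  c.p_mem n _ (X.α_mem n _ (c.i_mem n x hx))

theorem transferredTwist_pow_mem (k : ℕ) (n : ℤ) (x : H) (hx : x ∈ ℋ n) :
    (c.transferredTwist ^ k) x ∈ ℋ n := by
  induction k with
  | zero => simpa
  | succ k ih =>
    rw [pow_succ', Module.End.mul_apply]
    exact c.transferredTwist_mem _ _ ih

variable [DirectSum.Decomposition 𝒜] [DirectSum.Decomposition ℋ]
  (hα : ∀ a : A, X.α (c.h a) = c.h (X.α a))

/-- The suspended form of a DG hom-associative algebra with a contraction. -/
def suspendedData : SuspendedData K A where
  d := X.d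
  b := X.μ ∘ₗ suspParity 𝒜
  α := X.α
  σ := suspParity 𝒜
  -- The sign turns `1 - i p = d h + h d` into `d η + η d = P - 1`.
  η := -c.h
  P := c.i ∘ₗ c.p
  α_d := LinearMap.ext X.α_d
  α_σ := LinearMap.ext fun x => map_suspParity_of_degree_zero X.α X.α_mem x
  α_η := LinearMap.ext fun x => by simp [hα]
  α_b x y := by
    rw [LinearMap.comp_apply, X.α_μ, map_suspParity_of_degree_zero X.α X.α_mem]
    rfl
  σ_η x := by
    simp only [LinearMap.neg_apply, map_neg, neg_neg]
    rw [map_suspParity (ℬ := 𝒜) c.h 1 c.h_mem x]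
    simp
  σ_b x y := by
    simp only [LinearMap.comp_apply]
    rw [X.suspParity_μ]
  d_b x y := by
    simp only [LinearMap.comp_apply]
    rw [X.d_μ, X.suspParity_d, map_neg, LinearMap.neg_apply, neg_neg]
  b_b x y z := by
    simp only [LinearMap.comp_apply]
    rw [X.suspParity_μ, suspParity_suspParity, suspParity_suspParity, X.hom_assoc, map_neg,
      LinearMap.neg_apply, neg_add_cancel]
  d_η x := by
    have := c.homotopy x
    simp only [LinearMap.comp_apply, LinearMap.neg_apply, map_neg, sub_neg_eq_add]
    rw [← neg_sub, this]
    abel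

end Contraction

/-! ### Operations on `H` in suspended form -/

namespace Contraction

variable {K A H : Type*} [Field K] [AddCommGroup A] [Module K A] [AddCommGroup H] [Module K H]
  {𝒜 : ℤ → Submodule K A} {ℋ : ℤ → Submodule K H}
  {X : DGHomAssoc 𝒜} {Y : ChainCx ℋ} (c : Contraction X.toChainCx Y)
  [DirectSum.Decomposition 𝒜] (hα : ∀ a : A, X.α (c.h a) = c.h (X.α a))

/-- Only homotopies shift the degree: there is one per internal edge, and one more at the root of a
rooted operation with at least one vertex. -/
theorem ops_mem (n : ℕ) :
    (∀ (e : ℕ → ℤ) (v : ℕ → A), (∀ q, v q ∈ 𝒜 (e q)) →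
      (c.suspendedData hα).rootedOps n v ∈ 𝒜 (∑ q ∈ range (n + 1), e q + n)) ∧
    (∀ (e : ℕ → ℤ) (v : ℕ → A), (∀ q, v q ∈ 𝒜 (e q)) →
      (c.suspendedData hα).treeOps (n + 1) v ∈ 𝒜 (∑ q ∈ range (n + 2), e q + n)) := by
  refine SuspendedData.ops_induction
    (p := fun n => ∀ (e : ℕ → ℤ) (v : ℕ → A), (∀ q, v q ∈ 𝒜 (e q)) →
      (c.suspendedData hα).rootedOps n v ∈ 𝒜 (∑ q ∈ range (n + 1), e q + n))
    (p' := fun n => ∀ (e : ℕ → ℤ) (v : ℕ → A), (∀ q, v q ∈ 𝒜 (e q)) →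
      (c.suspendedData hα).treeOps (n + 1) v ∈ 𝒜 (∑ q ∈ range (n + 2), e q + n)) ?_ ?_ ?_ n
  · intro e v hv
    simpa using hv 0
  · intro n h e v hv
    rw [SuspendedData.rootedOps_succ]
    have := c.h_mem _ _ (h e v hv)
    rw [add_assoc] at this
    push_cast
    exact Submodule.neg_mem _ this
  · intro n h e v hv
    rw [SuspendedData.treeOps_succ]
    refine Submodule.sum_mem _ fun x hx => ?_
    have hx := mem_antidiagonal.1 hx
    have h1 := h x.1 (by omega) e v hv
    have h2 := h x.2 (by omega) (fun q => e (x.1 + 1 + q)) (fun q => v (x.1 + 1 + q))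
      fun q => hv _
    have hpow : ∀ (k : ℕ) (m : ℤ) (a : A), a ∈ 𝒜 m → (X.α ^ k) a ∈ 𝒜 m := by
      intro k m a ha
      induction k with
      | zero => simpa
      | succ k ih =>
        rw [pow_succ', Module.End.mul_apply]
        exact X.α_mem _ _ ih
    have := X.μ_mem _ _ _ _ (suspParity_mem (hpow x.2 _ _ h1)) (hpow x.1 _ _ h2)
    rw [show n + 2 = x.1 + 1 + (x.2 + 1) by omega, Finset.sum_range_add, ← hx]
    push_cast
    refine (congrArg (fun m => _ ∈ 𝒜 m) ?_).mp this
    ring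

/-- The suspended form of the transferred operation with `n + 1` arguments. -/
def suspendedOps : ℕ → (ℕ → H) → H
  | 0, v => Y.d (v 0)
  | n + 1, v => c.p ((c.suspendedData hα).treeOps (n + 1) fun q => c.i (v q))

theorem suspendedOps_congr {n : ℕ} {v w : ℕ → H} (h : ∀ q ≤ n, v q = w q) :
    c.suspendedOps hα n v = c.suspendedOps hα n w := by
  cases n with
  | zero => rw [suspendedOps, suspendedOps, h 0 le_rfl]
  | succ n =>
    rw [suspendedOps, suspendedOps]
    exact congrArg c.p (SuspendedData.treeOps_congr _ fun q hq => by rw [h q hq])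

theorem suspendedOps_update (n : ℕ) (v : ℕ → H) (q : ℕ) (hq : q ≤ n) :
    ∃ L : H →ₗ[K] H, ∀ x, c.suspendedOps hα n (Function.update v q x) = L x := by
  cases n with
  | zero =>
    obtain rfl : q = 0 := by omega
    exact ⟨Y.d, fun x => by simp [suspendedOps]⟩
  | succ n =>
    obtain ⟨L, hL⟩ := ((c.suspendedData hα).ops_update n).2 (fun q => c.i (v q)) q hq
    refine ⟨c.p ∘ₗ L ∘ₗ c.i, fun x => ?_⟩
    rw [LinearMap.comp_apply, LinearMap.comp_apply, ← hL, suspendedOps]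
    congr 2
    funext u
    exact Function.apply_update (fun _ => c.i) v q x u

theorem suspendedOps_smul (n l : ℕ) (hl : l ≤ n + 1) (s : ℕ → ℤˣ) (v : ℕ → H) :
    c.suspendedOps hα n (fun q => if q < l then s q • v q else v q) =
      (∏ q ∈ range l, s q) • c.suspendedOps hα n v := by
  induction l with
  | zero => simp
  | succ l ih =>
    set w : ℕ → H := fun q => if q < l then s q • v q else v q
    obtain ⟨L, hL⟩ := c.suspendedOps_update hα n w l (by omega)
    have h1 : (fun q => if q < l + 1 then s q • v q else v q) =
        Function.update w l (s l • v l) := by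
      funext q
      by_cases hq : q = l
      · subst hq; simp
      · rw [Function.update_of_ne hq]
        simp only [w, Nat.lt_succ_iff_lt_or_eq, hq, or_false]
    have h2 : w = Function.update w l (v l) := by
      rw [eq_comm, Function.update_eq_self_iff]
      simp [w]
    rw [h1, hL, map_intUnits_smul, ← hL, ← h2, ih (by omega), smul_smul, prod_range_succ,
      mul_comm]

theorem suspendedOps_twist (n : ℕ) (v : ℕ → H) :
    c.suspendedOps hα n (fun q => c.transferredTwist (v q)) =
      c.transferredTwist (c.suspendedOps hα n v) := by
  cases n with
  | zero => rw [suspendedOps, suspendedOps, c.transferredTwist_d hα]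
  | succ n =>
    rw [suspendedOps, suspendedOps, c.transferredTwist_p hα]
    simp only [c.i_transferredTwist hα]
    exact congrArg c.p (((c.suspendedData hα).ops_α n).2 fun q => c.i (v q))

theorem suspendedOps_mem (n : ℕ) (e : ℕ → ℤ) (v : ℕ → H) (hv : ∀ q, v q ∈ ℋ (e q)) :
    c.suspendedOps hα n v ∈ ℋ (∑ q ∈ range (n + 1), e q + n - 1) := by
  cases n with
  | zero => simpa [suspendedOps] using Y.d_mem _ _ (hv 0)
  | succ n =>
    have := c.p_mem _ _ ((c.ops_mem hα n).2 e (fun q => c.i (v q)) fun q => c.i_mem _ _ (hv q))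
    rw [suspendedOps]
    push_cast
    rwa [← add_assoc, add_sub_cancel_right]

variable [DirectSum.Decomposition ℋ]

theorem suspendedOps_suspParity (n : ℕ) (v : ℕ → H) :
    c.suspendedOps hα n (fun q => suspParity ℋ (v q)) =
      -suspParity ℋ (c.suspendedOps hα n v) := by
  cases n with
  | zero => rw [suspendedOps, suspendedOps, Y.suspParity_d, neg_neg]
  | succ n =>
    rw [suspendedOps, suspendedOps, ← map_suspParity_of_degree_zero c.p c.p_mem]
    simp only [map_suspParity_of_degree_zero c.i c.i_mem, ← map_neg]
    refine congrArg c.p (Eq.trans ?_ (map_neg (suspParity 𝒜) _).symm)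
    exact ((c.suspendedData hα).ops_σ n).2 fun q => c.i (v q)

theorem suspendedOps_suspParity_pow (n k : ℕ) (v : ℕ → H) :
    c.suspendedOps hα n (fun q => (suspParity ℋ ^ k) (v q)) =
      (k : ℤ).negOnePow • (suspParity ℋ ^ k) (c.suspendedOps hα n v) := by
  induction k with
  | zero => simp
  | succ k ih =>
    simp only [pow_succ', Module.End.mul_apply]
    rw [c.suspendedOps_suspParity hα n fun q => (suspParity ℋ ^ k) (v q), ih, map_intUnits_smul]
    push_cast
    rw [Int.negOnePow_succ, Units.neg_smul]

/-- Because `P = i ∘ p` and `i` is a chain map, what is inserted in `A` is the image under `i` of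
what is inserted in `H`. -/
theorem i_insertAt_suspendedOps (i l : ℕ) (v : ℕ → H) :
    (fun q => c.i (insertAt (c.suspendedOps hα i)
      (fun x => suspParity ℋ ((c.transferredTwist ^ i) x))
      (fun x => (c.transferredTwist ^ i) x) i l v q)) =
    (c.suspendedData hα).ins i l fun q => c.i (v q) := by
  funext q
  simp only [insertAt, SuspendedData.ins]
  split_ifs
  · rw [map_suspParity_of_degree_zero c.i c.i_mem, c.i_transferredTwist_pow hα]
    rfl
  · cases i with
    | zero => exact c.i_d _
    | succ i => rfl
  · exact c.i_transferredTwist_pow hα _ _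

/-- The relations between the transferred operations in suspended form. -/
theorem suspendedOps_relation (n : ℕ) (v : ℕ → H) :
    ∑ x ∈ antidiagonal n, ∑ l ∈ range (x.2 + 1), c.suspendedOps hα x.2
      (insertAt (c.suspendedOps hα x.1) (fun y => suspParity ℋ ((c.transferredTwist ^ x.1) y))
        (fun y => (c.transferredTwist ^ x.1) y) x.1 l v) = 0 := by
  cases n with
  | zero => simp [suspendedOps, insertAt, Y.d_d]
  | succ n =>
    have h := congrArg c.p ((c.suspendedData hα).d_treeOps n fun q => c.i (v q))
    rw [Finset.Nat.sum_antidiagonal_succ']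
    simp only [zero_add, range_one, sum_singleton, suspendedOps, insertAt_zero_zero,
      i_insertAt_suspendedOps]
    rw [map_zero, map_add, map_sum] at h
    simp only [map_sum] at h
    rw [← c.p_d]
    exact h

end Contraction

/-! ### From sequences to multilinear maps -/

/-- The extension of a finite tuple by zero to a sequence. -/
def extendZero {V : Type*} [Zero V] {n : ℕ} (v : Fin n → V) : ℕ → V :=
  fun q => if h : q < n then v ⟨q, h⟩ else 0

section extendZero

variable {V : Type*} [Zero V] {n : ℕ}

@[simp] theorem extendZero_coe (v : Fin n → V) (q : Fin n) : extendZero v q = v q := by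
  simp [extendZero]

theorem extendZero_of_lt (x : ℕ → V) {q : ℕ} (h : q < n) :
    extendZero (fun u : Fin n => x u) q = x q := by
  simp [extendZero, h]

theorem extendZero_update [DecidableEq (Fin n)] (v : Fin n → V) (q : Fin n) (x : V) :
    extendZero (Function.update v q x) = Function.update (extendZero v) q x := by
  funext u
  by_cases h : u = q
  · subst h; simp
  · rw [Function.update_of_ne h]
    simp only [extendZero]
    split_ifs with hu
    · rw [Function.update_of_ne]
      exact fun e => h (congrArg Fin.val e)
    · rfl

end extendZero

/-- The multilinear map on `n`-tuples given by a function of sequences that is linear in each of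
the first `n` entries. -/
def MultilinearMap.ofSequences {K V : Type*} [Field K] [AddCommGroup V] [Module K V] (n : ℕ)
    (f : (ℕ → V) → V)
    (hf : ∀ (v : ℕ → V) (q : ℕ), q < n → ∃ L : V →ₗ[K] V, ∀ x, f (Function.update v q x) = L x) :
    MultilinearMap K (fun _ : Fin n => V) V where
  toFun v := f (extendZero v)
  map_update_add' v q x y := by
    obtain ⟨L, hL⟩ := hf (extendZero v) q q.2
    simp only [extendZero_update, hL, map_add]
  map_update_smul' v q a x := by
    obtain ⟨L, hL⟩ := hf (extendZero v) q q.2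
    simp only [extendZero_update, hL, map_smul]

/-! ### Desuspension -/

namespace Contraction

variable {K A H : Type*} [Field K] [AddCommGroup A] [Module K A] [AddCommGroup H] [Module K H]
  {𝒜 : ℤ → Submodule K A} {ℋ : ℤ → Submodule K H}
  {X : DGHomAssoc 𝒜} {Y : ChainCx ℋ} (c : Contraction X.toChainCx Y)
  [DirectSum.Decomposition 𝒜] [DirectSum.Decomposition ℋ]
  (hα : ∀ a : A, X.α (c.h a) = c.h (X.α a))

/-- The transferred operation with `n + 1` arguments. -/
def transferredOps (n : ℕ) (v : ℕ → H) : H :=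
  c.suspendedOps hα n fun q => (suspParity ℋ ^ (n - q)) (v q)

theorem transferredOps_congr {n : ℕ} {v w : ℕ → H} (h : ∀ q ≤ n, v q = w q) :
    c.transferredOps hα n v = c.transferredOps hα n w :=
  c.suspendedOps_congr hα fun q hq => by rw [h q hq]

theorem transferredOps_update (n : ℕ) (v : ℕ → H) (q : ℕ) (hq : q < n + 1) :
    ∃ L : H →ₗ[K] H, ∀ x, c.transferredOps hα n (Function.update v q x) = L x := by
  obtain ⟨L, hL⟩ := c.suspendedOps_update hα n (fun u => (suspParity ℋ ^ (n - u)) (v u)) q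
    (Nat.lt_succ_iff.1 hq)
  refine ⟨L ∘ₗ suspParity ℋ ^ (n - q), fun x => ?_⟩
  rw [LinearMap.comp_apply, ← hL, transferredOps]
  congr 1
  funext u
  exact Function.apply_update (fun u => (suspParity ℋ ^ (n - u) : Module.End K H)) v q x u

theorem transferredOps_twist (n : ℕ) (v : ℕ → H) :
    c.transferredOps hα n (fun q => c.transferredTwist (v q)) =
      c.transferredTwist (c.transferredOps hα n v) := by
  rw [transferredOps, transferredOps, ← suspendedOps_twist]
  simp only [map_suspParity_pow_of_degree_zero c.transferredTwist c.transferredTwist_mem]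

theorem transferredOps_mem (n : ℕ) (e : ℕ → ℤ) (v : ℕ → H) (hv : ∀ q, v q ∈ ℋ (e q)) :
    c.transferredOps hα n v ∈ ℋ (∑ q ∈ range (n + 1), e q + n - 1) :=
  c.suspendedOps_mem hα n e _ fun q => suspParity_pow_mem (hv q) _

/-- The sign that relates a term of the suspended relations to a term of the relations of an
`HA_∞`-algebra. -/
theorem suspendedOps_insertAt (a b t : ℕ) (ht : t ≤ b) (e : ℕ → ℤ) (v : ℕ → H)
    (hv : ∀ q, v q ∈ ℋ (e q)) :
    c.suspendedOps hα b (insertAt (c.suspendedOps hα a)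
      (fun y => suspParity ℋ ((c.transferredTwist ^ a) y))
      (fun y => (c.transferredTwist ^ a) y) a t
      (fun q => (suspParity ℋ ^ (a + b - q)) (v q))) =
    ((a + 1) * ∑ q ∈ range t, e q + a * t + b : ℤ).negOnePow •
      c.transferredOps hα b (insertAt (c.transferredOps hα a)
        (fun y => (c.transferredTwist ^ a) y) (fun y => (c.transferredTwist ^ a) y) a t v) := by
  set T : ℕ → H := fun q => (suspParity ℋ ^ (b - q)) (insertAt (c.transferredOps hα a)
    (fun y => (c.transferredTwist ^ a) y) (fun y => (c.transferredTwist ^ a) y) a t v q) with hT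
  -- Sign by slot. Left of `t`, the entry has `a + 1` more parities than needed: `a` from the change
  -- of arity and one from the prefix map. At `t`, the power `b - t` is pulled out of the odd inner
  -- operation. Right of `t`, the shift of the index by `a` makes the powers agree.
  let s : ℕ → ℤˣ := fun q =>
    if q < t then ((a + 1) * (e q + 1) : ℤ).negOnePow else (b - t : ℤ).negOnePow
  have key := c.suspendedOps_smul hα b (t + 1) (by omega) s T
  have hs : ∏ q ∈ range (t + 1), s q =
      ((a + 1) * ∑ q ∈ range t, e q + a * t + b : ℤ).negOnePow := by
    have h : ∀ k ≤ t, ∏ q ∈ range k, s q =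
        ((a + 1) * (∑ q ∈ range k, e q + k) : ℤ).negOnePow := by
      intro k hk
      induction k with
      | zero => simp
      | succ k ih =>
        rw [prod_range_succ, sum_range_succ, ih (by omega)]
        simp only [s]
        rw [if_pos (by omega), ← Int.negOnePow_add]
        congr 1
        push_cast
        ring
    rw [prod_range_succ, h t le_rfl]
    simp only [s, lt_irrefl, if_false]
    rw [← Int.negOnePow_add]
    congr 1
    ring
  rw [hs] at key
  rw [transferredOps, ← key]
  have htwist : ∀ (k : ℕ) (y : H), (c.transferredTwist ^ a) ((suspParity ℋ ^ k) y) =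
      (suspParity ℋ ^ k) ((c.transferredTwist ^ a) y) :=
    map_suspParity_pow_of_degree_zero (c.transferredTwist ^ a) (c.transferredTwist_pow_mem a)
  refine c.suspendedOps_congr hα fun q hq => ?_
  rcases lt_trichotomy q t with h | rfl | h
  · rw [insertAt_of_lt _ _ _ _ _ _ h, if_pos (by omega)]
    simp only [s, hT, insertAt, h, if_true]
    have hm := suspParity_pow_mem (c.transferredTwist_pow_mem a _ _ (hv q)) (b - q)
    rw [show a + b - q = a + (b - q) by omega, htwist, ← Module.End.pow_add_apply,
      ← Module.End.mul_apply, ← pow_succ', suspParity_pow_of_mem hm]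
    push_cast
    rfl
  · rw [if_pos (by omega)]
    simp only [s, hT, insertAt, lt_irrefl, if_false, if_true, transferredOps]
    rw [← Nat.cast_sub ht, ← suspendedOps_suspParity_pow]
    refine c.suspendedOps_congr hα fun u hu => ?_
    rw [Module.End.pow_add_apply]
    congr 2
    omega
  · rw [if_neg (by omega)]
    simp only [hT, insertAt, if_neg (show ¬ q < t by omega), if_neg (show ¬ q = t by omega)]
    rw [htwist]
    congr 2
    omega

theorem transferredOps_relation (n : ℕ) (e : ℕ → ℤ) (v : ℕ → H) (hv : ∀ q, v q ∈ ℋ (e q)) :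
    ∑ x ∈ antidiagonal n, ∑ t ∈ range (x.2 + 1),
      ((t + 1) * (x.1 + 2) + (x.1 + 1) * ∑ q ∈ range t, e q : ℤ).negOnePow •
      c.transferredOps hα x.2 (insertAt (c.transferredOps hα x.1)
        (fun y => (c.transferredTwist ^ x.1) y) (fun y => (c.transferredTwist ^ x.1) y)
        x.1 t v) = 0 := by
  have h := congrArg (fun y => (n : ℤ).negOnePow • y)
    (c.suspendedOps_relation hα n fun q => (suspParity ℋ ^ (n - q)) (v q))
  rw [smul_zero, Finset.smul_sum] at h
  rw [← h]
  refine Finset.sum_congr rfl fun x hx => ?_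
  obtain ⟨a, b⟩ := x
  obtain rfl : a + b = n := HasAntidiagonal.mem_antidiagonal.1 hx
  rw [Finset.smul_sum]
  refine Finset.sum_congr rfl fun t ht => ?_
  rw [c.suspendedOps_insertAt hα a b t (Nat.lt_succ_iff.1 (Finset.mem_range.1 ht)) e v hv,
    smul_smul, ← Int.negOnePow_add]
  congr 1
  -- With the global factor `(-1)^n`, where `n = a + b`, the exponents agree up to an even number.
  refine Int.negOnePow_congr ⟨t + 1 - b, ?_⟩
  push_cast
  ring

/-- The transferred operations as multilinear maps. -/
def transferredMaps : (k : ℕ) → MultilinearMap K (fun _ : Fin k => H) H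
  | 0 => 0
  | n + 1 => MultilinearMap.ofSequences (n + 1) (c.transferredOps hα n)
      (c.transferredOps_update hα n)

theorem transferredMaps_succ (n : ℕ) (v : Fin (n + 1) → H) :
    c.transferredMaps hα (n + 1) v = c.transferredOps hα n (extendZero v) := rfl

theorem transferredMaps_coe (n : ℕ) (x : ℕ → H) :
    c.transferredMaps hα (n + 1) (fun q => x q) = c.transferredOps hα n x :=
  c.transferredOps_congr hα fun _ hq => extendZero_of_lt x (Nat.lt_succ_iff.2 hq)

/-- A pure change of indices from `transferredOps_relation`: `i = a + 1`, `j = b + 1` and `l = t +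
1`. -/
theorem transferredMaps_relation (n : ℕ) (hn : 1 ≤ n) (e : ℕ → ℤ) (v : ℕ → H)
    (hv : ∀ q, v q ∈ ℋ (e q)) :
    ∑ i ∈ Finset.Icc 1 n, ∑ l ∈ Finset.Icc 1 (n + 1 - i),
      Int.negOnePow (l * (i + 1) + i * ∑ q ∈ Finset.range (l - 1), e q) •
        c.transferredMaps hα (n + 1 - i) (fun q =>
          if (q : ℕ) + 1 < l then (c.transferredTwist ^ (i - 1)) (v q)
          else if (q : ℕ) + 1 = l then c.transferredMaps hα i (fun u => v (q + u))
          else (c.transferredTwist ^ (i - 1)) (v (q + (i - 1)))) = 0 := by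
  obtain ⟨N, rfl⟩ : ∃ N, n = N + 1 := ⟨n - 1, by omega⟩
  rw [← c.transferredOps_relation hα N e v hv]
  symm
  refine Finset.sum_nbij' (fun x => x.1 + 1) (fun i => (i - 1, N + 1 - i)) ?_ ?_ ?_ ?_ ?_
  · rintro ⟨a, b⟩ h
    have := HasAntidiagonal.mem_antidiagonal.1 h
    simp only [Finset.mem_Icc]
    omega
  · intro i h
    have := Finset.mem_Icc.1 h
    rw [HasAntidiagonal.mem_antidiagonal]
    dsimp only
    omega
  · rintro ⟨a, b⟩ h
    obtain rfl : a + b = N := HasAntidiagonal.mem_antidiagonal.1 h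
    simp only [Prod.mk.injEq]
    omega
  · intro i h
    have := Finset.mem_Icc.1 h
    dsimp only
    omega
  · rintro ⟨a, b⟩ h
    obtain rfl : a + b = N := HasAntidiagonal.mem_antidiagonal.1 h
    dsimp only
    rw [show a + b + 1 + 1 - (a + 1) = b + 1 by omega]
    refine Finset.sum_nbij' (fun t => t + 1) (fun l => l - 1) ?_ ?_ ?_ ?_ ?_
    · intro t ht
      have := Finset.mem_range.1 ht
      rw [Finset.mem_Icc]
      omega
    · intro l hl
      have := Finset.mem_Icc.1 hl
      rw [Finset.mem_range]
      omega
    · intro t _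
      rfl
    · intro l hl
      have := Finset.mem_Icc.1 hl
      omega
    · intro t ht
      rw [← c.transferredMaps_coe hα b]
      refine congrArg₂ (· • ·) (congrArg _ ?_) (congrArg _ ?_)
      · simp only [add_tsub_cancel_right]
        push_cast
        ring
      · funext q
        simp only [insertAt, add_lt_add_iff_right, add_left_inj, add_tsub_cancel_right]
        split_ifs with h1 h2
        · rfl
        · rw [h2]
          exact (c.transferredMaps_coe hα a fun u => v (t + u)).symm
        · rfl

/-- The `HA_∞`-structure transferred along a contraction. -/
def transferredHAInfinity : HAInfinity ℋ where
  μ := c.transferredMaps hα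
  α := c.transferredTwist
  μ_zero := rfl
  μ_mem k hk e v hv := by
    obtain ⟨n, rfl⟩ : ∃ n, k = n + 1 := ⟨k - 1, by omega⟩
    -- Padding by zero is harmless, as zero lies in every degree.
    have := c.transferredOps_mem hα n (extendZero e) (extendZero v) fun q => by
      simp only [extendZero]
      split_ifs
      · exact hv _
      · exact zero_mem _
    rw [transferredMaps_succ]
    rw [Finset.sum_range] at this
    simp only [extendZero_coe] at this
    refine (congrArg (fun m => _ ∈ ℋ m) ?_).mp this
    push_cast
    ring
  α_mem := c.transferredTwist_mem
  α_μ k hk v := by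
    obtain ⟨n, rfl⟩ : ∃ n, k = n + 1 := ⟨k - 1, by omega⟩
    rw [transferredMaps_succ, transferredMaps_succ, ← transferredOps_twist]
    congr 1
    funext q
    simp only [extendZero]
    split_ifs
    · rfl
    · exact map_zero _
  relation := c.transferredMaps_relation hα

end Contraction

/-! ### Comparison with the signed tree operations -/

section treeSum

variable {K A : Type*} [Field K] [AddCommGroup A] [Module K A]

theorem applyHomotopy_eq {A : Type*} (h : A → A) (T : BinaryTree Unit) (x : A) :
    applyHomotopy h T x = homotopyAbove h T.numNodes x := by
  cases T <;> rfl

theorem homotopyAbove_sum {ι : Type*} (h : A →ₗ[K] A) (n : ℕ) (s : Finset ι) (f : ι → A) :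
    homotopyAbove h n (∑ j ∈ s, f j) = ∑ j ∈ s, homotopyAbove h n (f j) := by
  cases n with
  | zero => rfl
  | succ n => exact map_sum h f s

theorem sum_treesOfNumNodesEq_succ {M : Type*} [AddCommMonoid M] (n : ℕ)
    (f : BinaryTree Unit → M) :
    ∑ T ∈ BinaryTree.treesOfNumNodesEq (n + 1), f T =
      ∑ x ∈ antidiagonal n, ∑ L ∈ BinaryTree.treesOfNumNodesEq x.1,
        ∑ R ∈ BinaryTree.treesOfNumNodesEq x.2, f (BinaryTree.node () L R) := by
  rw [BinaryTree.treesOfNumNodesEq_succ, Finset.sum_biUnion]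
  · refine Finset.sum_congr rfl fun x _ => ?_
    rw [BinaryTree.pairwiseNode, Finset.sum_map, Finset.sum_product]
    rfl
  · simp_rw [Set.PairwiseDisjoint, Set.Pairwise, disjoint_left]
    aesop

variable (μ : A →ₗ[K] A →ₗ[K] A) (α : Module.End K A) (h : A →ₗ[K] A)

theorem treeSum_one (e : ℕ → ℤ) (a : ℕ → A) : treeSum μ α h 1 e a = a 0 := by
  simp [treeSum, treeOp]

/-- Splitting all trees at the root gives `treeSum` the same recursion as `treeOps`, up to signs. -/
theorem treeSum_succ (n : ℕ) (e : ℕ → ℤ) (a : ℕ → A) :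
    treeSum μ α h (n + 2) e a = ∑ x ∈ antidiagonal n,
      ((x.1 + 1) * (x.2 + 2) + x.2 * ∑ q ∈ range (x.1 + 1), e q : ℤ).negOnePow •
        μ ((α ^ x.2) (homotopyAbove h x.1 (treeSum μ α h (x.1 + 1) e a)))
          ((α ^ x.1) (homotopyAbove h x.2 (treeSum μ α h (x.2 + 1)
            (fun q => e (x.1 + 1 + q)) fun q => a (x.1 + 1 + q)))) := by
  rw [treeSum, show n + 2 - 1 = n + 1 by omega, sum_treesOfNumNodesEq_succ]
  refine Finset.sum_congr rfl fun x _ => ?_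
  simp only [treeSum, add_tsub_cancel_right, homotopyAbove_sum, map_sum, LinearMap.sum_apply,
    Finset.smul_sum]
  rw [Finset.sum_comm]
  refine Finset.sum_congr rfl fun R hR => Finset.sum_congr rfl fun L hL => ?_
  rw [BinaryTree.mem_treesOfNumNodesEq] at hL hR
  rw [treeOp]
  simp only [applyHomotopy_eq, BinaryTree.numLeaves_eq_numNodes_succ, hL, hR,
    add_tsub_cancel_right]
  congr 2
  push_cast
  ring

end treeSum

namespace Contraction

variable {K A H : Type*} [Field K] [AddCommGroup A] [Module K A] [AddCommGroup H] [Module K H]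
  {𝒜 : ℤ → Submodule K A} {ℋ : ℤ → Submodule K H}
  {X : DGHomAssoc 𝒜} {Y : ChainCx ℋ} (c : Contraction X.toChainCx Y)
  [DirectSum.Decomposition 𝒜] (hα : ∀ a : A, X.α (c.h a) = c.h (X.α a))

/-- The sign `(-1)^n` comes from the `n` homotopies `η = -h`. Every other sign is accounted for by
the parities on the entries, which reproduce the sign of `treeOp` at each vertex. -/
theorem ops_eq_treeSum (n : ℕ) :
    (∀ (e : ℕ → ℤ) (a : ℕ → A), (∀ q, a q ∈ 𝒜 (e q)) →
      (c.suspendedData hα).rootedOps n (fun q => (suspParity 𝒜 ^ (n - q)) (a q)) =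
        (n : ℤ).negOnePow • homotopyAbove c.h n (treeSum X.μ X.α c.h (n + 1) e a)) ∧
    (∀ (e : ℕ → ℤ) (a : ℕ → A), (∀ q, a q ∈ 𝒜 (e q)) →
      (c.suspendedData hα).treeOps (n + 1) (fun q => (suspParity 𝒜 ^ (n + 1 - q)) (a q)) =
        (n : ℤ).negOnePow • treeSum X.μ X.α c.h (n + 2) e a) := by
  refine SuspendedData.ops_induction
    (p := fun n => ∀ (e : ℕ → ℤ) (a : ℕ → A), (∀ q, a q ∈ 𝒜 (e q)) →
      (c.suspendedData hα).rootedOps n (fun q => (suspParity 𝒜 ^ (n - q)) (a q)) =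
        (n : ℤ).negOnePow • homotopyAbove c.h n (treeSum X.μ X.α c.h (n + 1) e a))
    (p' := fun n => ∀ (e : ℕ → ℤ) (a : ℕ → A), (∀ q, a q ∈ 𝒜 (e q)) →
      (c.suspendedData hα).treeOps (n + 1) (fun q => (suspParity 𝒜 ^ (n + 1 - q)) (a q)) =
        (n : ℤ).negOnePow • treeSum X.μ X.α c.h (n + 2) e a) ?_ ?_ ?_ n
  · intro e a _
    simp [homotopyAbove, treeSum_one]
  · intro n h e a ha
    rw [SuspendedData.rootedOps_succ, h e a ha, map_intUnits_smul]
    push_cast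
    rw [Int.negOnePow_succ, Units.neg_smul, ← smul_neg]
    rfl
  · intro n h e a ha
    rw [SuspendedData.treeOps_succ, treeSum_succ, Finset.smul_sum]
    refine Finset.sum_congr rfl fun x hx => ?_
    obtain ⟨r, s⟩ := x
    obtain rfl : r + s = n := HasAntidiagonal.mem_antidiagonal.1 hx
    dsimp only
    -- The left subtree needs the powers `r - q`; the surplus `s + 1` is pulled out and, with the
    -- parity inside `b`, becomes `s + 2` parities on an element of degree `e 0 + ⋯ + e r + r`.
    have hL : (c.suspendedData hα).rootedOps r
        (fun q => (suspParity 𝒜 ^ (r + s + 1 - q)) (a q)) =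
        (suspParity 𝒜 ^ (s + 1)) ((c.suspendedData hα).rootedOps r
          fun q => (suspParity 𝒜 ^ (r - q)) (a q)) := by
      refine Eq.trans ?_ ((c.suspendedData hα).rootedOps_σ_pow r (s + 1) _)
      refine (c.suspendedData hα).rootedOps_congr fun q hq => ?_
      refine Eq.trans ?_ (Module.End.pow_add_apply (suspParity 𝒜) (s + 1) (r - q) (a q)).symm
      congr 2
      omega
    have hR : (fun q => (suspParity 𝒜 ^ (r + s + 1 - (r + 1 + q))) (a (r + 1 + q))) =
        fun q => (suspParity 𝒜 ^ (s - q)) (a (r + 1 + q)) := by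
      funext q
      congr 2
      omega
    have hm := (c.ops_mem hα r).1 e (fun q => (suspParity 𝒜 ^ (r - q)) (a q))
      fun q => suspParity_pow_mem (ha q) _
    have hb : ∀ y z : A, (c.suspendedData hα).b (((c.suspendedData hα).α ^ s) y) z =
        X.μ ((X.α ^ s) (suspParity 𝒜 y)) z := fun y z =>
      congrArg (fun w => X.μ w z) ((c.suspendedData hα).α_σ.end_pow_apply s y).symm
    rw [hL, hR, hb, ← Module.End.mul_apply (suspParity 𝒜), ← pow_succ', suspParity_pow_of_mem hm,
      h r (by omega) e a ha, h s (by omega) (fun q => e (r + 1 + q)) (fun q => a (r + 1 + q))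
        fun q => ha _]
    simp only [map_intUnits_smul, smul_smul, ← Int.negOnePow_add]
    change _ = _ • X.μ _ (((c.suspendedData hα).α ^ r) _)
    simp only [Units.smul_def, LinearMap.smul_apply, smul_smul, ← Units.val_mul,
      ← Int.negOnePow_add]
    congr 2
    -- The factor `s + 2` above exceeds by two the coefficient `s` of the degrees in the sign of
    -- `treeSum_succ`.
    refine Int.negOnePow_congr ⟨∑ q ∈ range (r + 1), e q, ?_⟩
    push_cast
    ring

end Contraction

theorem mainTheorem2 {K A H : Type*} [Field K] [AddCommGroup A] [Module K A]
    [AddCommGroup H] [Module K H]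
    (𝒜 : ℤ → Submodule K A) [DirectSum.Decomposition 𝒜]
    (ℋ : ℤ → Submodule K H) [DirectSum.Decomposition ℋ]
    (X : DGHomAssoc 𝒜) (Y : ChainCx ℋ) (c : Contraction X.toChainCx Y)
    (hα : ∀ a : A, X.α (c.h a) = c.h (X.α a)) :
    ∃ S : HAInfinity ℋ,
      (∀ x : H, S.α x = c.p (X.α (c.i x))) ∧
      (∀ x : Fin 1 → H, S.μ 1 x = Y.d (x 0)) ∧
      (∀ k : ℕ, 2 ≤ k → ∀ (e : ℕ → ℤ) (x : ℕ → H), (∀ q, x q ∈ ℋ (e q)) →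
        S.μ k (fun q => x q) =
          Int.negOnePow k • c.p (treeSum X.μ X.α c.h k e (fun q => c.i (x q)))) := by
  refine ⟨c.transferredHAInfinity hα, fun x => rfl, fun x => ?_, fun k hk e x hx => ?_⟩
  · refine (c.transferredMaps_succ hα 0 x).trans ?_
    simp [Contraction.transferredOps, Contraction.suspendedOps, extendZero]
  · obtain ⟨n, rfl⟩ : ∃ n, k = n + 2 := ⟨k - 2, by omega⟩
    refine (c.transferredMaps_coe hα (n + 1) x).trans ?_
    rw [Contraction.transferredOps, Contraction.suspendedOps]
    simp only [map_suspParity_pow_of_degree_zero c.i c.i_mem]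
    rw [(c.ops_eq_treeSum hα n).2 e (fun q => c.i (x q)) fun q => c.i_mem _ _ (hx q),
      map_intUnits_smul]
    congr 1
    refine Int.negOnePow_congr ⟨-1, ?_⟩
    push_cast
    ring
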